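/- **Setting.** Let $M$ and $N$ be smooth $n$-dimensional manifolds. Let $V$ be a finite-dimensional real vector space on which $GL(n,\mathbb R)$ acts by affine (for instance linear) transformations $a(g)$. A *field* on $M$ is a smooth section of the bundle associated with the frame bundle $LM$ by this action, that is, a smooth function $\phi:LM\to V$ with $\phi(f\circ g)=a(g)^{-1}\phi(f)$ (tensor and pseudo-tensor fields of any type, and collections of them, are of this form). A *variation* is a smooth function on $LM$ with the same equivariance under the linear part of $a$. Diffeomorphisms act on fields by pullback. The *field space* $\Phi$ is any set of fields on $M$ that is stable under $\phi\mapsto R_\psi\phi=\phi^\psi:=\psi^*\phi$ for all $\psi\in\mathrm{Diff}(M)$, and $\pi:\Phi\to\Phi/\mathrm{Diff}(M)$ is the projection to the moduli space. Smoothness on these infinite-dimensional spaces is in the diffeological sense. The plots of $\Phi$, of spaces of variations and of $\mathrm{Diff}(N,M)$ (the set of smooth diffeomorphisms $N\to M$) are the jointly smooth families parametrised by $\mathbb R^m$, subsets carry the subspace diffeology and quotients the quotient diffeology. A $k$-form $\boldsymbol\alpha$ on such a space $X$, with values in a diffeological vector space $W$, assigns to every plot $P:\mathbb R^m\to X$ a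 smooth $W$-valued $k$-form $P^\star\boldsymbol\alpha$ on $\mathbb R^m$, compatibly with smooth reparametrisations of plots. The basis one-form $\boldsymbol d\phi$ maps the velocity of a family of fields to that velocity, as a variation. A form $\boldsymbol\alpha$ on $\Phi$ is *invariant* if $R_\psi^\star\boldsymbol\alpha=\boldsymbol\alpha$ for all $\psi\in\mathrm{Diff}(M)$, *horizontal* if it vanishes whenever one of its arguments is a fundamental vertical vector $X^v_{|\phi}=\frac{d}{d\tau}\psi_\tau^*\phi|_{\tau=0}$, and *basic* if it is both. A smooth map $\boldsymbol\psi:\Phi\to\mathrm{Diff}(M)$ (a *field-dependent diffeomorphism*) acts on forms by $\boldsymbol\alpha^{\boldsymbol\psi}:=\Xi^\star\boldsymbol\alpha$, where $\Xi(\phi)=\boldsymbol\psi(\phi)^*\phi$. Let $\boldsymbol u:\Phi\to\mathrm{Diff}(N,M)$ be a *field-dependent dressing field*: a smooth map with $\boldsymbol u(\psi^*\phi)=\psi^{-1}\circ\boldsymbol u(\phi)$ for all $\psi\in\mathrm{Diff}(M)$ and $\phi\in\Phi$. Let $F_{\boldsymbol u}(\phi)=\phi^{\boldsymbol u}:=\boldsymbol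 u(\phi)^*\phi$ be the *dressing map* and $\Phi^{\boldsymbol u}:=F_{\boldsymbol u}(\Phi)$ the space of dressed fields, a set of fields on $N$. Let $\boldsymbol d[\phi]$ be the basis one-form of the fields on $N$ and $\boldsymbol d\phi^{\boldsymbol u}:=F_{\boldsymbol u}^\star\boldsymbol d[\phi]$ the *dressed basis one-form*. **Theorem.** 1. The dressing map is $\mathrm{Diff}(M)$-invariant: $F_{\boldsymbol u}\circ R_\psi=F_{\boldsymbol u}$ for all $\psi\in\mathrm{Diff}(M)$. 2. It realises the bundle projection: there is a diffeomorphism (of diffeological spaces) $e:\Phi/\mathrm{Diff}(M)\to\Phi^{\boldsymbol u}$ with $e\circ\pi=F_{\boldsymbol u}$. 3. On every tangent vector $\mathfrak X$ of $\Phi$ at $\phi$ (velocity of a plot), $$\boldsymbol d\phi^{\boldsymbol u}(\mathfrak X)=\boldsymbol u(\phi)^*\bigl(\boldsymbol d\phi(\mathfrak X)+\mathfrak L_{\boldsymbol{du}(\mathfrak X)\circ\boldsymbol u(\phi)^{-1}}\,\phi\bigr),$$ where $\mathfrak L$ is the Lie derivative along the vector field $\boldsymbol{du}(\mathfrak X)\circ\boldsymbol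 u(\phi)^{-1}$ on $M$. In short, $\boldsymbol d\phi^{\boldsymbol u}=\boldsymbol u^*(\boldsymbol d\phi+\mathfrak L_{\boldsymbol{du}\circ\boldsymbol u^{-1}}\phi)$. 4. The form $\boldsymbol d\phi^{\boldsymbol u}$ is basic, and $(\boldsymbol d\phi^{\boldsymbol u})^{\boldsymbol\psi}=\boldsymbol d\phi^{\boldsymbol u}$ for every smooth $\boldsymbol\psi:\Phi\to\mathrm{Diff}(M)$. 5. Let $W$ be a diffeological vector space and $k\ge0$. For every $W$-valued $k$-form $\bar{\boldsymbol\alpha}$ on $\Phi^{\boldsymbol u}$ the dressed form $\boldsymbol\alpha^{\boldsymbol u}:=F_{\boldsymbol u}^\star\bar{\boldsymbol\alpha}$ is basic, and $(\boldsymbol\alpha^{\boldsymbol u})^{\boldsymbol\psi}=\boldsymbol\alpha^{\boldsymbol u}$ for every smooth $\boldsymbol\psi:\Phi\to\mathrm{Diff}(M)$. If $\bar{\boldsymbol\alpha}=\alpha(\wedge^\bullet\boldsymbol d[\phi];[\phi])$, with $\alpha(\,\cdot\,;\phi')$ alternating multilinear on variations on $N$ for every $\phi'\in\Phi^{\boldsymbol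 u}$, then $\boldsymbol\alpha^{\boldsymbol u}=\alpha(\wedge^\bullet\boldsymbol d\phi^{\boldsymbol u};\phi^{\boldsymbol u})$. Conversely, every basic $W$-valued $k$-form on $\Phi$ is $F_{\boldsymbol u}^\star\bar{\boldsymbol\alpha}$ for exactly one form $\bar{\boldsymbol\alpha}$ on $\Phi^{\boldsymbol u}$. -/

import Mathlib

open Diffeology
open scoped Manifold ContDiff

set_option linter.unusedSectionVars false
set_option linter.unusedVariables false

namespace Dressing

noncomputable section

/-- Euclidean space `ℝᵐ`. -/
abbrev Euc (m : ℕ) : Type := EuclideanSpace ℝ (Fin m)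

section Diffeological

/-- The subspace diffeology. -/
instance subtypeDiffeology {X : Type*} [DiffeologicalSpace X] (s : X → Prop) :
    DiffeologicalSpace {x : X // s x} where
  plots m := {p | IsPlot fun r => (p r : X)}
  constant_plots x := isPlot_const (x := (x : X))
  plot_reparam hp hf := isPlot_reparam hp hf
  locality h := DiffeologicalSpace.locality h

theorem exists_smooth_retract {m : ℕ} {U : Set (Euc m)} (hU : IsOpen U) {x : Euc m} (hx : x ∈ U) :
    ∃ c : Euc m → Euc m, ContDiff ℝ ∞ c ∧ (∀ y, c y ∈ U) ∧ ∃ W, IsOpen W ∧ x ∈ W ∧ ∀ y ∈ W, c y = y := by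
  obtain ⟨ε, hε, hεU⟩ := Metric.isOpen_iff.mp hU x hx
  let b : ContDiffBump x := ⟨ε / 4, ε / 2, by positivity, by linarith⟩
  refine ⟨fun y => x + b y • (y - x), ?_, ?_, Metric.ball x (ε / 4), Metric.isOpen_ball,
    Metric.mem_ball_self (by positivity), ?_⟩
  · exact contDiff_const.add (b.contDiff.smul (contDiff_id.sub contDiff_const))
  · intro y
    apply hεU
    rw [Metric.mem_ball, dist_eq_norm, add_sub_cancel_left, norm_smul]
    by_cases hy : dist y x < ε / 2
    · have h1 : ‖b y‖ ≤ 1 := by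
        rw [Real.norm_of_nonneg b.nonneg]; exact b.le_one
      rw [dist_eq_norm] at hy
      nlinarith [norm_nonneg (y - x), norm_nonneg (b y)]
    · have : b y = 0 := b.zero_of_le_dist (not_lt.mp hy)
      simpa [this] using hε
  · intro y hy
    have : b y = 1 := b.one_of_mem_closedBall (Metric.ball_subset_closedBall hy)
    simp [this]

/-- The quotient diffeology: a map is a plot if it lifts locally to plots. -/
instance quotientDiffeology {X : Type*} [DiffeologicalSpace X] (s : Setoid X) :
    DiffeologicalSpace (Quotient s) where
  plots m := {p | ∀ r : Euc m, ∃ U : Set (Euc m), IsOpen U ∧ r ∈ U ∧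
    ∃ q : Euc m → X, IsPlot q ∧ ∀ r' ∈ U, p r' = Quotient.mk s (q r')}
  constant_plots x r := by
    obtain ⟨y, rfl⟩ := Quotient.exists_rep x
    exact ⟨Set.univ, isOpen_univ, trivial, fun _ => y, isPlot_const, fun _ _ => rfl⟩
  plot_reparam {n m p f} hp hf r := by
    obtain ⟨U, hU, hr, q, hq, h⟩ := hp (f r)
    exact ⟨f ⁻¹' U, hU.preimage hf.continuous, hr, q ∘ f, isPlot_reparam hq hf, fun r' hr' => h _ hr'⟩
  locality {n p} hp r := by
    obtain ⟨U, hU, hr, h⟩ := hp r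
    obtain ⟨c, hc, hcU, W, hW, hrW, hcW⟩ := exists_smooth_retract hU hr
    obtain ⟨U', hU', hr', q, hq, h'⟩ := h hcU hc r
    refine ⟨U' ∩ W, hU'.inter hW, ⟨hr', hrW⟩, q, hq, fun y hy => ?_⟩
    rw [← h' y hy.1, Function.comp_apply, hcW y hy.2]

/-- The plots `ℝᵐ → X` of a diffeological space. -/
def Plot (X : Type*) [DiffeologicalSpace X] (m : ℕ) : Type _ := {p : Euc m → X // IsPlot p}

instance {X : Type*} [DiffeologicalSpace X] (m : ℕ) : CoeFun (Plot X m) fun _ => Euc m → X :=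
  ⟨Subtype.val⟩

/-- Smooth reparametrisation of a plot. -/
def Plot.reparam {X : Type*} [DiffeologicalSpace X] {m l : ℕ} (p : Plot X m) (f : Euc l → Euc m)
    (hf : ContDiff ℝ ∞ f) : Plot X l :=
  ⟨p.1 ∘ f, isPlot_reparam p.2 hf⟩

/-- The image of a plot under a smooth map. -/
def Plot.map {X Y : Type*} [DiffeologicalSpace X] [DiffeologicalSpace Y] {m : ℕ} (p : Plot X m)
    (f : X → Y) (hf : DSmooth f) : Plot Y m :=
  ⟨f ∘ p.1, hf m p.1 p.2⟩

/-- A differential `k`-form on a diffeological space `X` with values in `W`: it attaches to every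
plot `p : ℝᵐ → X` a smooth `W`-valued `k`-form on `ℝᵐ` (thought of as `p⋆α`), compatibly with smooth
reparametrisations. The value at `r` on `v₁, …, v_k` is the value of the form at the point `p r` on
the velocities of the plot `p` at `r` in the directions `v₁, …, v_k`. -/
@[ext]
structure DiffForm (X : Type*) [DiffeologicalSpace X] (W : Type*) [AddCommGroup W] [Module ℝ W]
    [DiffeologicalSpace W] (k : ℕ) where
  toFun : ∀ {m : ℕ}, Plot X m → Euc m → (Euc m) [⋀^Fin k]→ₗ[ℝ] W
  smooth' : ∀ {m : ℕ} (p : Plot X m) (v : Fin k → Euc m), IsPlot fun r => toFun p r v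
  reparam' : ∀ {m l : ℕ} (p : Plot X m) (f : Euc l → Euc m) (hf : ContDiff ℝ ∞ f) (r : Euc l)
    (v : Fin k → Euc l), toFun (p.reparam f hf) r v = toFun p (f r) fun i => fderiv ℝ f r (v i)

instance {X : Type*} [DiffeologicalSpace X] {W : Type*} [AddCommGroup W] [Module ℝ W]
    [DiffeologicalSpace W] {k : ℕ} : CoeFun (DiffForm X W k)
      fun _ => ∀ {m : ℕ}, Plot X m → Euc m → (Euc m) [⋀^Fin k]→ₗ[ℝ] W := ⟨DiffForm.toFun⟩

/-- The pullback `f⋆β`. -/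
def DiffForm.pullback {X Y : Type*} [DiffeologicalSpace X] [DiffeologicalSpace Y] {W : Type*}
    [AddCommGroup W] [Module ℝ W] [DiffeologicalSpace W] {k : ℕ} (f : X → Y) (hf : DSmooth f)
    (β : DiffForm Y W k) : DiffForm X W k where
  toFun p := β (p.map f hf)
  smooth' p v := β.smooth' (p.map f hf) v
  reparam' p g hg r v := β.reparam' (p.map f hf) g hg r v

end Diffeological

section Frames

variable (n : ℕ)

/-- A linear frame of `M`: a point of the frame bundle `LM`. -/
structure Frame (M : Type*) [TopologicalSpace M] [ChartedSpace (Euc n) M] where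
  base : M
  iso : Euc n ≃L[ℝ] TangentSpace 𝓘(ℝ, Euc n) base

/-- The total space of the vector bundle `Hom(ℝⁿ, TM)`, of which `LM` is an open submanifold. -/
abbrev FrameHom (M : Type*) [TopologicalSpace M] [ChartedSpace (Euc n) M]  : Type _ :=
  Bundle.TotalSpace (Euc n →L[ℝ] Euc n)
    (fun x : M => Bundle.Trivial M (Euc n) x →L[ℝ] TangentSpace 𝓘(ℝ, Euc n) x)

/-- The model with corners of the manifold `Hom(ℝⁿ, TM)`. -/
abbrev frameModel : ModelWithCorners ℝ (Euc n × (Euc n →L[ℝ] Euc n))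
    (ModelProd (Euc n) (Euc n →L[ℝ] Euc n)) :=
  𝓘(ℝ, Euc n).prod 𝓘(ℝ, Euc n →L[ℝ] Euc n)

variable {n} {M : Type*} [TopologicalSpace M] [ChartedSpace (Euc n) M]

/-- The inclusion of `LM` in `Hom(ℝⁿ, TM)`. -/
def Frame.toHom (p : Frame n M) : FrameHom n M := ⟨p.base, (p.iso : Euc n →L[ℝ] _)⟩

theorem Frame.toHom_injective : Function.Injective (Frame.toHom : Frame n M → FrameHom n M) := by
  rintro ⟨x, f⟩ ⟨y, g⟩ h
  obtain rfl : x = y := congrArg Bundle.TotalSpace.proj h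
  have h' : (f : Euc n →L[ℝ] TangentSpace 𝓘(ℝ, Euc n) x) = (g : Euc n →L[ℝ] TangentSpace 𝓘(ℝ, Euc n) x) := by
    simpa [Frame.toHom] using h
  congr 1
  exact ContinuousLinearEquiv.coe_injective h'

variable [IsManifold 𝓘(ℝ, Euc n) ∞ M] 


theorem inCoordinates_trivial {M' : Type*} [TopologicalSpace M'] [ChartedSpace (Euc n) M']
    [IsManifold 𝓘(ℝ, Euc n) ∞ M'] {B : Type*} [TopologicalSpace B] (b₀ b : B) (x₀ x : M')
    (L : Euc n →L[ℝ] TangentSpace 𝓘(ℝ, Euc n) x) :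
    ContinuousLinearMap.inCoordinates (Euc n) (Bundle.Trivial B (Euc n)) (Euc n)
      (fun y : M' => TangentSpace 𝓘(ℝ, Euc n) y) b₀ b x₀ x L =
      ((trivializationAt (Euc n) (TangentSpace 𝓘(ℝ, Euc n)) x₀).continuousLinearMapAt ℝ x).comp L := by
  ext v
  simp [ContinuousLinearMap.inCoordinates]

theorem isOpen_range_toHom :
    IsOpen (Set.range (Frame.toHom : Frame n M → FrameHom n M)) := by
  rw [isOpen_iff_mem_nhds]
  intro p₀ hp₀
  let e := trivializationAt (Euc n →L[ℝ] Euc n)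
    (fun x : M => Bundle.Trivial M (Euc n) x →L[ℝ] TangentSpace 𝓘(ℝ, Euc n) x) p₀.proj
  let S : Set (Euc n →L[ℝ] Euc n) := Set.range ((↑) : (Euc n ≃L[ℝ] Euc n) → Euc n →L[ℝ] Euc n)
  have hS : IsOpen S := ContinuousLinearEquiv.isOpen
  have key : ∀ p ∈ e.source, (p ∈ Set.range (Frame.toHom : Frame n M → FrameHom n M) ↔
      (e p).2 ∈ S) := by
    intro p hp
    have hb : p.proj ∈ (trivializationAt (Euc n) (TangentSpace 𝓘(ℝ, Euc n)) p₀.proj).baseSet := by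
      have := (e.mem_source).1 hp
      rw [hom_trivializationAt_baseSet] at this
      exact this.2
    let t := (trivializationAt (Euc n) (TangentSpace 𝓘(ℝ, Euc n)) p₀.proj).continuousLinearEquivAt
      ℝ p.proj hb
    have h2 : (e p).2 = (t : TangentSpace 𝓘(ℝ, Euc n) p.proj →L[ℝ] Euc n).comp p.2 := by
      rw [hom_trivializationAt_apply]
      exact (inCoordinates_trivial _ _ _ _ p.2).trans (by
        ext1 v
        exact (congrFun (Bundle.Trivialization.coe_continuousLinearEquivAt_eq _ hb) (p.2 v)).symm)
    rw [h2]
    constructor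
    · rintro ⟨q, rfl⟩
      exact ⟨q.iso.trans t, rfl⟩
    · rintro ⟨g, hg⟩
      refine ⟨⟨p.proj, g.trans t.symm⟩, ?_⟩
      obtain ⟨x, f⟩ := p
      simp only [Frame.toHom]
      congr 1
      ext v
      have := congrArg (fun L : Euc n →L[ℝ] Euc n => t.symm (L v)) hg
      simpa using this
  have hmem : p₀ ∈ e.source := FiberBundle.mem_trivializationAt_proj_source
  have hopen : IsOpen (e.source ∩ e ⁻¹' {q | q.2 ∈ S}) :=
    e.continuousOn.isOpen_inter_preimage e.open_source (hS.preimage continuous_snd)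
  filter_upwards [hopen.mem_nhds ⟨hmem, (key p₀ hmem).1 hp₀⟩] with p hp
  exact (key p hp.1).2 hp.2


variable {V : Type*} [NormedAddCommGroup V] [NormedSpace ℝ V]

/-- A function on `LM`, extended by zero to `Hom(ℝⁿ, TM)`. -/
def Frame.ext (φ : Frame n M → V) : FrameHom n M → V := Function.extend Frame.toHom φ 0

theorem Frame.ext_toHom (φ : Frame n M → V) (p : Frame n M) : Frame.ext φ p.toHom = φ p :=
  Frame.toHom_injective.extend_apply φ 0 p

/-- The family `P r` of functions on `LM` is jointly smooth on `U × LM`. -/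
def SmoothFamilyOn {m : ℕ} (P : Euc m → Frame n M → V) (U : Set (Euc m)) : Prop :=
  ContMDiffOn (𝓘(ℝ, Euc m).prod (frameModel n)) 𝓘(ℝ, V) ∞
    (fun q : Euc m × FrameHom n M => Frame.ext (P q.1) q.2)
    (U ×ˢ Set.range (Frame.toHom : Frame n M → FrameHom n M))

variable (n M V) in
/-- The smooth functions `LM → V`. -/
def frameFunctions : Submodule ℝ (Frame n M → V) where
  carrier := {φ | ContMDiffOn (frameModel n) 𝓘(ℝ, V) ∞ (Frame.ext φ) (Set.range Frame.toHom)}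
  zero_mem' := by
    refine (contMDiffOn_const (c := (0 : V))).congr ?_
    rintro _ ⟨p, rfl⟩
    simp [Frame.ext_toHom]
  add_mem' {φ χ} hφ hχ := by
    refine (ContMDiffOn.add hφ hχ).congr ?_
    rintro _ ⟨p, rfl⟩
    simp [Frame.ext_toHom]
  smul_mem' c φ hφ := by
    refine ((contMDiffOn_const (I := frameModel n) (I' := 𝓘(ℝ, ℝ)) (c := c)).smul hφ).congr ?_
    rintro _ ⟨p, rfl⟩
    simp [Frame.ext_toHom]

variable (n M V) in
/-- The space of smooth functions `LM → V`. -/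
abbrev FrameFunction : Type _ := frameFunctions n M V

/-- The plots are the jointly smooth families `ℝᵐ × LM → V`. -/
instance frameFunctionDiffeology : DiffeologicalSpace (FrameFunction n M V) :=
  .ofCorePlotsOn {
    isPlotOn := fun {_ U} _ P => SmoothFamilyOn (fun r => (P r : Frame n M → V)) U
    isPlotOn_congr := fun {_ U} hU p q h => contMDiffOn_congr fun x hx => by
      simp only [h hx.1]
    isPlot := fun P => SmoothFamilyOn (fun r => (P r : Frame n M → V)) Set.univ
    isPlotOn_univ := Iff.rfl
    isPlot_const := fun φ => ContMDiffOn.comp (t := Set.range Frame.toHom) φ.2 contMDiffOn_snd fun _ hq => hq.2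
    isPlotOn_reparam := fun {_ _ U W hU} hW p f h hp hf => by
      refine ContMDiffOn.comp (t := U ×ˢ Set.range Frame.toHom) hp
        (f := fun q : Euc _ × FrameHom n M => (f q.1, q.2)) ?_ fun q hq => ⟨h hq.1, hq.2⟩
      exact (hf.contMDiffOn.comp contMDiffOn_fst fun q hq => hq.1).prodMk contMDiffOn_snd
    locality := fun {_ U} hU p h q hq => by
      obtain ⟨W, hW, hqW, hp⟩ := h q.1 hq.1
      refine ((hp q ⟨hqW, hq.2⟩).contMDiffAt ?_).contMDiffWithinAt
      exact (hW.prod isOpen_range_toHom).mem_nhds ⟨hqW, hq.2⟩ }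

/-- The right action of `GL(n, ℝ)` on frames. -/
def Frame.act (p : Frame n M) (g : Euc n ≃L[ℝ] Euc n) : Frame n M := ⟨p.base, g.trans p.iso⟩

variable {N : Type*} [TopologicalSpace N] [ChartedSpace (Euc n) N] [IsManifold 𝓘(ℝ, Euc n) ∞ N]

/-- The smooth diffeomorphisms `N → M`. -/
abbrev Diffeo (n : ℕ) (N M : Type*) [TopologicalSpace N] [ChartedSpace (Euc n) N]
    [TopologicalSpace M] [ChartedSpace (Euc n) M] : Type _ :=
  N ≃ₘ^∞⟮𝓘(ℝ, Euc n), 𝓘(ℝ, Euc n)⟯ M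

/-- The plots are the families of diffeomorphisms that are jointly smooth, as maps `ℝᵐ × N → M`
(the family of inverses is then jointly smooth too, by the inverse function theorem). -/
instance diffeoDiffeology : DiffeologicalSpace (Diffeo n N M) :=
  .ofCorePlotsOn {
    isPlotOn := fun {m U} _ u => ContMDiffOn (𝓘(ℝ, Euc m).prod 𝓘(ℝ, Euc n)) 𝓘(ℝ, Euc n) ∞
      (fun q : Euc m × N => u q.1 q.2) (U ×ˢ Set.univ)
    isPlotOn_congr := fun {_ U} hU p q h => contMDiffOn_congr fun x hx => by
      simp only [h hx.1]
    isPlot := fun {m} u => ContMDiff (𝓘(ℝ, Euc m).prod 𝓘(ℝ, Euc n)) 𝓘(ℝ, Euc n) ∞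
      (fun q : Euc m × N => u q.1 q.2)
    isPlotOn_univ := by
      intro m p
      rw [Set.univ_prod_univ, contMDiffOn_univ]
    isPlot_const := fun u => u.contMDiff.comp contMDiff_snd
    isPlotOn_reparam := fun {_ _ U W hU} hW p f h hp hf => by
      refine ContMDiffOn.comp (t := U ×ˢ Set.univ) hp
        (f := fun q : Euc _ × N => (f q.1, q.2)) ?_ fun q hq => ⟨h hq.1, hq.2⟩
      exact (hf.contMDiffOn.comp contMDiffOn_fst fun q hq => hq.1).prodMk contMDiffOn_snd
    locality := fun {_ U} hU p h q hq => by
      obtain ⟨W, hW, hqW, hp⟩ := h q.1 hq.1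
      refine ((hp q ⟨hqW, hq.2⟩).contMDiffAt ?_).contMDiffWithinAt
      exact (hW.prod isOpen_univ).mem_nhds ⟨hqW, hq.2⟩ }

/-- The induced map of frame bundles `f ↦ Tu ∘ f`. -/
def Frame.map (u : Diffeo n N M) (p : Frame n N) : Frame n M :=
  ⟨u p.base, p.iso.trans (u.mfderivToContinuousLinearEquiv (by simp) p.base)⟩

theorem contMDiff_frame_map {m : ℕ} (u : Plot (Diffeo n N M) m) :
    ContMDiff (𝓘(ℝ, Euc m).prod (frameModel n)) (frameModel n) ∞
      (fun q : Euc m × FrameHom n N =>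
        (⟨u q.1 q.2.1, (mfderiv 𝓘(ℝ, Euc n) 𝓘(ℝ, Euc n) (u q.1) q.2.1).comp q.2.2⟩ :
          FrameHom n M)) := by
  intro q₀
  rw [contMDiffAt_hom_bundle]
  have hb : ContMDiffAt (𝓘(ℝ, Euc m).prod (frameModel n)) 𝓘(ℝ, Euc n) ∞
      (fun q : Euc m × FrameHom n N => q.2.1) q₀ :=
    (Bundle.contMDiff_proj _).contMDiffAt.comp _ contMDiffAt_snd
  have hu : ContMDiff (𝓘(ℝ, Euc m).prod 𝓘(ℝ, Euc n)) 𝓘(ℝ, Euc n) ∞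
      (fun q : Euc m × N => u q.1 q.2) := u.2
  have h1 : ContMDiffAt (𝓘(ℝ, Euc m).prod (frameModel n)) 𝓘(ℝ, Euc n) ∞
      (fun q : Euc m × FrameHom n N => u q.1 q.2.1) q₀ :=
    hu.contMDiffAt.comp q₀ (contMDiffAt_fst.prodMk hb)
  refine ⟨h1, ?_⟩
  have h2 := ContMDiffAt.mfderiv (x₀ := q₀) (m := ∞) (n := ∞) (I := 𝓘(ℝ, Euc n)) (I' := 𝓘(ℝ, Euc n))
    (J := 𝓘(ℝ, Euc m).prod (frameModel n))
    (fun q : Euc m × FrameHom n N => (u q.1 : N → M)) (fun q => q.2.1)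
    (hu.contMDiffAt.comp _ ((contMDiffAt_fst.comp _ contMDiffAt_fst).prodMk contMDiffAt_snd)) hb (by simp)
  have h3 := ((contMDiffAt_hom_bundle (fun q : Euc m × FrameHom n N => q.2)).1
    (contMDiff_snd (I := 𝓘(ℝ, Euc m)) (J := frameModel n) (n := ∞) q₀)).2
  refine (h2.clm_comp h3).congr_of_eventuallyEq ?_
  have hmem : ∀ᶠ q : Euc m × FrameHom n N in nhds q₀,
      q.2.proj ∈ (trivializationAt (Euc n) (TangentSpace 𝓘(ℝ, Euc n)) q₀.2.proj).baseSet :=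
    hb.continuousAt.preimage_mem_nhds ((trivializationAt (Euc n) (TangentSpace 𝓘(ℝ, Euc n))
      q₀.2.proj).open_baseSet.mem_nhds (FiberBundle.mem_baseSet_trivializationAt' q₀.2.proj))
  filter_upwards [hmem] with q hq
  refine (inCoordinates_trivial _ _ _ _ _).trans ?_
  refine Eq.trans ?_ (congrArg _ (inCoordinates_trivial _ _ _ _ _)).symm
  ext1 v
  simp only [inTangentCoordinates, ContinuousLinearMap.inCoordinates, ContinuousLinearMap.comp_apply]
  rw [Bundle.Trivialization.symmL_continuousLinearMapAt _ hq]

theorem SmoothFamilyOn.comp_frame_map {m : ℕ} {P : Euc m → Frame n M → V}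
    (hP : SmoothFamilyOn P Set.univ) (u : Plot (Diffeo n N M) m) :
    SmoothFamilyOn (fun r (p : Frame n N) => P r (p.map (u r))) Set.univ := by
  have h := ContMDiffOn.comp (t := Set.univ ×ˢ Set.range Frame.toHom) hP
    (s := Set.univ ×ˢ (Set.range (Frame.toHom : Frame n N → FrameHom n N)))
    ((contMDiff_fst.prodMk (contMDiff_frame_map u)).contMDiffOn) (by
      rintro ⟨r, _⟩ ⟨-, p, rfl⟩
      exact ⟨trivial, p.map (u r), rfl⟩)
  refine h.congr ?_
  rintro ⟨r, _⟩ ⟨-, p, rfl⟩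
  exact (Frame.ext_toHom _ p).trans (Frame.ext_toHom (P r) (p.map (u r))).symm

theorem smoothFamilyOn_const {φ : Frame n M → V} (m : ℕ) :
    SmoothFamilyOn (fun _ : Euc m => φ) Set.univ ↔ φ ∈ frameFunctions n M V := by
  constructor
  · intro h
    exact ContMDiffOn.comp (t := Set.univ ×ˢ Set.range Frame.toHom) h
      (contMDiffOn_const (c := (0 : Euc m)) |>.prodMk contMDiffOn_id) fun q hq => ⟨trivial, hq⟩
  · intro h
    exact ContMDiffOn.comp (t := Set.range Frame.toHom) h contMDiffOn_snd fun _ hq => hq.2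

theorem SmoothFamilyOn.mem {m : ℕ} {P : Euc m → Frame n M → V}
    (hP : SmoothFamilyOn P Set.univ) (r : Euc m) : P r ∈ frameFunctions n M V :=
  ContMDiffOn.comp (t := Set.univ ×ˢ Set.range Frame.toHom) hP
      (contMDiffOn_const (c := r) |>.prodMk contMDiffOn_id) fun q hq => ⟨trivial, hq⟩

/-- The pointwise derivative at `r` in the direction `v` of a family of functions on `LM`. -/
def velocity {m : ℕ} (P : Euc m → Frame n M → V) (r v : Euc m) : Frame n M → V :=
  fun p => fderiv ℝ (fun r' => P r' p) r v

theorem SmoothFamilyOn.differentiable {m : ℕ} {P : Euc m → Frame n M → V}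
    (hP : SmoothFamilyOn P Set.univ) (p : Frame n M) : ContDiff ℝ ∞ fun r => P r p := by
  rw [← contMDiff_iff_contDiff]
  have h : ContMDiffOn 𝓘(ℝ, Euc m) 𝓘(ℝ, V) ∞ (fun r => Frame.ext (P r) p.toHom) Set.univ :=
    ContMDiffOn.comp (t := Set.univ ×ˢ Set.range Frame.toHom) hP
      (contMDiffOn_id.prodMk (contMDiffOn_const (c := p.toHom))) fun q hq => ⟨trivial, p, rfl⟩
  simpa [Frame.ext_toHom, contMDiffOn_univ] using h

theorem SmoothFamilyOn.velocity {m : ℕ} {P : Euc m → Frame n M → V}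
    (hP : SmoothFamilyOn P Set.univ) (v : Euc m) :
    SmoothFamilyOn (fun r => velocity P r v) Set.univ := by
  rintro ⟨r₀, _⟩ ⟨-, p₀, rfl⟩
  refine ContMDiffAt.contMDiffWithinAt ?_
  have hopen : IsOpen ((Set.univ : Set (Euc m)) ×ˢ Set.range (Frame.toHom : Frame n M → FrameHom n M)) :=
    isOpen_univ.prod isOpen_range_toHom
  have hP' : ContMDiffAt (𝓘(ℝ, Euc m).prod (frameModel n)) 𝓘(ℝ, V) ∞
      (fun q : Euc m × FrameHom n M => Frame.ext (P q.1) q.2) (r₀, p₀.toHom) :=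
    (hP _ ⟨trivial, p₀, rfl⟩).contMDiffAt (hopen.mem_nhds ⟨trivial, p₀, rfl⟩)
  have h := ContMDiffAt.mfderiv (x₀ := (r₀, p₀.toHom)) (m := ∞) (n := ∞) (I := 𝓘(ℝ, Euc m))
    (I' := 𝓘(ℝ, V)) (J := 𝓘(ℝ, Euc m).prod (frameModel n))
    (fun (q : Euc m × FrameHom n M) (r : Euc m) => Frame.ext (P r) q.2) (fun q => q.1)
    (hP'.comp ((r₀, p₀.toHom), r₀) (contMDiffAt_snd.prodMk (contMDiffAt_snd.comp _ contMDiffAt_fst)))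
    contMDiffAt_fst (by simp)
  have h' : ContMDiffAt (𝓘(ℝ, Euc m).prod (frameModel n)) 𝓘(ℝ, Euc m →L[ℝ] V) ∞
      (fun q : Euc m × FrameHom n M => fderiv ℝ (fun r => Frame.ext (P r) q.2) q.1)
      (r₀, p₀.toHom) := by
    have e := inTangentCoordinates_model_space (I := 𝓘(ℝ, Euc m)) (I' := 𝓘(ℝ, V))
      (fun q : Euc m × FrameHom n M => q.1) (fun q => Frame.ext (P q.1) q.2)
      (fun q => fderiv ℝ (fun r => Frame.ext (P r) q.2) q.1) (r₀, p₀.toHom)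
    rw [← e]
    simp only [mfderiv_eq_fderiv] at h
    exact h
  refine (h'.clm_apply (contMDiffAt_const (c := v))).congr_of_eventuallyEq ?_
  filter_upwards [hopen.mem_nhds (x := (r₀, p₀.toHom)) ⟨trivial, p₀, rfl⟩]
  rintro ⟨r, _⟩ ⟨-, p, rfl⟩
  rw [Frame.ext_toHom]
  simp only [Frame.ext_toHom]
  rfl


section Fields

variable (a : (Euc n ≃L[ℝ] Euc n) →* (V ≃ᵃ[ℝ] V))

variable (M) in
/-- Fields on `M`: the smooth sections of the bundle associated with the frame bundle `LM` by the
affine (in particular, possibly linear) action `a` of `GL(n, ℝ)` on `V`, written as equivariant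
functions on `LM`, `φ(f ∘ g) = a(g)⁻¹ φ(f)`. Tensor and pseudo-tensor fields of any type, and finite
collections of them, are of this form. -/
abbrev FieldConfig : Type _ :=
  {φ : FrameFunction n M V // ∀ (p : Frame n M) (g : Euc n ≃L[ℝ] Euc n),
    φ.1 (p.act g) = a g⁻¹ (φ.1 p)}

variable (M) in
/-- Variations of fields: the smooth sections of the associated vector bundle given by the linear
part of `a`. -/
def variations : Submodule ℝ (FrameFunction n M V) where
  carrier := {χ | ∀ (p : Frame n M) (g : Euc n ≃L[ℝ] Euc n),
    χ.1 (p.act g) = (a g⁻¹).linear (χ.1 p)}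
  zero_mem' p g := by simp
  add_mem' {χ χ'} h h' p g := by
    have h₁ := h p g
    have h₂ := h' p g
    simp_all
  smul_mem' c χ h p g := by
    have h₁ := h p g
    simp_all

variable (M) in
/-- The vector space of variations, in which the velocities of families of fields lie. -/
abbrev Variation : Type _ := variations M a

variable {a}

instance : CoeFun (FieldConfig M a) fun _ => Frame n M → V := ⟨fun φ => φ.1.1⟩

/-- The pullback `u^*φ` of a field along a diffeomorphism. -/
def FieldConfig.pullback (u : Diffeo n N M) (φ : FieldConfig M a) : FieldConfig N a :=
  ⟨⟨fun p => φ (p.map u), (((smoothFamilyOn_const 0).2 φ.1.2).comp_frame_map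
    ⟨fun _ => u, isPlot_const⟩).mem 0⟩, fun p g => φ.2 (p.map u) g⟩

/-- The pullback of functions on frames. -/
def pullbackFrameFunction (u : Diffeo n N M) (f : Frame n M → V) : Frame n N → V :=
  fun p => f (p.map u)

theorem Frame.map_refl (p : Frame n M) : p.map (Diffeomorph.refl 𝓘(ℝ, Euc n) M ∞) = p := by
  apply Frame.toHom_injective
  have : mfderiv 𝓘(ℝ, Euc n) 𝓘(ℝ, Euc n) (Diffeomorph.refl 𝓘(ℝ, Euc n) M ∞) p.base =
      ContinuousLinearMap.id ℝ _ := mfderiv_id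
  change (⟨p.base, (mfderiv 𝓘(ℝ, Euc n) 𝓘(ℝ, Euc n) (Diffeomorph.refl 𝓘(ℝ, Euc n) M ∞) p.base).comp
    p.toHom.2⟩ : FrameHom n M) = ⟨p.base, p.toHom.2⟩
  rw [this]
  rfl

theorem Frame.map_trans {M' : Type*} [TopologicalSpace M'] [ChartedSpace (Euc n) M']
    [IsManifold 𝓘(ℝ, Euc n) ∞ M'] (u : Diffeo n N M) (w : Diffeo n M M') (p : Frame n N) :
    p.map (u.trans w) = (p.map u).map w := by
  apply Frame.toHom_injective
  have h : mfderiv 𝓘(ℝ, Euc n) 𝓘(ℝ, Euc n) (u.trans w) p.base =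
      (mfderiv 𝓘(ℝ, Euc n) 𝓘(ℝ, Euc n) w (u p.base)).comp
        (mfderiv 𝓘(ℝ, Euc n) 𝓘(ℝ, Euc n) u p.base) :=
    mfderiv_comp p.base (w.mdifferentiable (by simp) _) (u.mdifferentiable (by simp) _)
  change (⟨w (u p.base), (mfderiv 𝓘(ℝ, Euc n) 𝓘(ℝ, Euc n) (u.trans w) p.base).comp
    p.toHom.2⟩ : FrameHom n M') = _
  rw [h]
  rfl

theorem FieldConfig.pullback_refl (φ : FieldConfig M a) :
    φ.pullback (Diffeomorph.refl 𝓘(ℝ, Euc n) M ∞) = φ := by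
  apply Subtype.ext
  apply Subtype.ext
  funext p
  exact congrArg φ (Frame.map_refl p)

theorem FieldConfig.pullback_pullback {M' : Type*} [TopologicalSpace M'] [ChartedSpace (Euc n) M']
    [IsManifold 𝓘(ℝ, Euc n) ∞ M'] (u : Diffeo n N M) (w : Diffeo n M M') (φ : FieldConfig M' a) :
    (φ.pullback w).pullback u = φ.pullback (u.trans w) := by
  apply Subtype.ext
  apply Subtype.ext
  funext p
  exact (congrArg φ (Frame.map_trans u w p)).symm

theorem FieldConfig.isPlot_pullback {m : ℕ} (u : Plot (Diffeo n N M) m) (P : Plot (FieldConfig M a) m) :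
    IsPlot fun r => (P r).pullback (u r) :=
  SmoothFamilyOn.comp_frame_map (P := fun r => (P r : Frame n M → V)) P.2 u

variable (M a) in
/-- The basis 1-form `dφ` on the space of fields: its value on the velocity of a family of fields is
that velocity, as a variation. -/
def basisForm [FiniteDimensional ℝ V] : DiffForm (FieldConfig M a) (Variation M a) 1 where
  toFun {m} P r := AlternatingMap.ofSubsingleton ℝ (Euc m) (Variation M a) (0 : Fin 1)
    { toFun := fun v => ⟨⟨velocity (fun r => (P r : Frame n M → V)) r v,
          (SmoothFamilyOn.velocity (P := fun r => (P r : Frame n M → V)) P.2 v).mem r⟩, by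
        intro p g
        have h1 : (fun r => (P r : Frame n M → V) (p.act g)) =
            fun r => a g⁻¹ ((P r : Frame n M → V) p) := funext fun r => (P r).2 p g
        have h2 : DifferentiableAt ℝ (fun r => (P r : Frame n M → V) p) r :=
          ((SmoothFamilyOn.differentiable (P := fun r => (P r : Frame n M → V)) P.2 p).differentiable (by simp)).differentiableAt
        have h3 : (fun r => (P r : Frame n M → V) (p.act g)) =
            fun r => (a g⁻¹).linear.toLinearMap.toContinuousLinearMap ((P r : Frame n M → V) p) +
              a g⁻¹ 0 := by
          rw [h1]
          funext r
          exact congrFun (AffineMap.decomp (a g⁻¹).toAffineMap) _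
        have h4 := ((((a g⁻¹).linear.toLinearMap.toContinuousLinearMap.hasFDerivAt).comp r
          h2.hasFDerivAt).add_const (a g⁻¹ 0)).fderiv
        change fderiv ℝ (fun r => (P r : Frame n M → V) (p.act g)) r v = _
        rw [h3]
        exact congrArg (fun L : Euc m →L[ℝ] V => L v) h4⟩
      map_add' := fun v w => by
        ext p
        simp [velocity]
      map_smul' := fun c v => by
        ext p
        simp [velocity] }
  smooth' P v := SmoothFamilyOn.velocity (P := fun r => (P r : Frame n M → V)) P.2 (v 0)
  reparam' {m l} P f hf r v := by
    apply Subtype.ext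
    apply Subtype.ext
    funext p
    have h2 : DifferentiableAt ℝ (fun r => (P r : Frame n M → V) p) (f r) :=
      ((SmoothFamilyOn.differentiable (P := fun r => (P r : Frame n M → V)) P.2 p).differentiable (by simp)).differentiableAt
    have h3 : DifferentiableAt ℝ f r := (hf.differentiable (by simp)).differentiableAt
    have := fderiv_comp r h2 h3
    exact congrArg (fun L : Euc l →L[ℝ] V => L (v 0)) this


variable (a) in
/-- The basis 1-form `dφ` on a subspace of the space of fields. -/
def basisFormOn [FiniteDimensional ℝ V] (S : Set (FieldConfig M a)) : DiffForm S (Variation M a) 1 :=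
  (basisForm M a).pullback (fun φ : S => φ.1) fun _ _ hP => hP

/-- The form `β` has the functional expression `A`: `β = A(∧ dφ; φ)`, where `A(·; φ)` is alternating
multilinear on variations. -/
def HasExpression [FiniteDimensional ℝ V] {S : Set (FieldConfig M a)}
    {W : Type*} [AddCommGroup W] [Module ℝ W] [DiffeologicalSpace W] {k : ℕ}
    (β : DiffForm S W k) (A : S → (Variation M a) [⋀^Fin k]→ₗ[ℝ] W) : Prop :=
  ∀ {m : ℕ} (Q : Plot S m) (r : Euc m) (v : Fin k → Euc m),
    β Q r v = A (Q r) fun i => basisFormOn a S Q r fun _ => v i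

/-- The coordinate expression, in the chart at `x`, of a vector field `X`. -/
def localVectorField (X : ∀ x : M, TangentSpace 𝓘(ℝ, Euc n) x) (x : M) : Euc n → Euc n := fun z =>
  (trivializationAt (Euc n) (TangentSpace 𝓘(ℝ, Euc n)) x).continuousLinearMapAt ℝ
    ((extChartAt 𝓘(ℝ, Euc n) x).symm z) (X ((extChartAt 𝓘(ℝ, Euc n) x).symm z))

/-- The natural lift of a vector field `X` to the frame bundle, at the frame `p`. In the chart of
`Hom(ℝⁿ, TM)` at `p`, which is induced by the chart of `M` at the base point, it is `(X, DX ∘ p)`: the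
velocity of `τ ↦ Tw_τ ∘ p` if `w_τ` has velocity `X` at `w_0 = id`. -/
def frameLift (X : ∀ x : M, TangentSpace 𝓘(ℝ, Euc n) x) (p : Frame n M) :
    TangentSpace (frameModel n) p.toHom :=
  ((X p.base, (fderiv ℝ (localVectorField X p.base) (extChartAt 𝓘(ℝ, Euc n) p.base p.base)).comp
    p.toHom.2) : Euc n × (Euc n →L[ℝ] Euc n))

/-- The Lie derivative `𝔏_X φ`: the derivative of the function `φ` on `LM` along the natural lift of
`X`. -/
def lieDerivative (X : ∀ x : M, TangentSpace 𝓘(ℝ, Euc n) x) (φ : Frame n M → V) : Frame n M → V :=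
  fun p => mfderiv (frameModel n) 𝓘(ℝ, V) (Frame.ext φ) p.toHom (frameLift X p)

variable (M a) in
/-- A field space `Φ`: a set of fields on `M` that is stable under `Diff(M)`. -/
structure FieldSpace where
  carrier : Set (FieldConfig M a)
  stable : ∀ (ψ : Diffeo n M M) (φ : FieldConfig M a), φ ∈ carrier → φ.pullback ψ ∈ carrier

instance : CoeSort (FieldSpace M a) (Type _) := ⟨fun Φ => Φ.carrier⟩

variable {Φ : FieldSpace M a}

/-- The right action `φ ↦ R_ψ φ = φ^ψ = ψ^*φ` of `Diff(M)`. -/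
def FieldSpace.act (ψ : Diffeo n M M) (φ : Φ) : Φ := ⟨φ.1.pullback ψ, Φ.stable ψ φ.1 φ.2⟩

/-- The plot `r ↦ ψ(r)^* P(r)`. -/
def FieldSpace.actPlot {m : ℕ} (ψ : Plot (Diffeo n M M) m) (P : Plot Φ m) : Plot Φ m :=
  ⟨fun r => FieldSpace.act (ψ r) (P r), FieldConfig.isPlot_pullback ψ ⟨fun r => (P r).1, P.2⟩⟩

/-- The map `Ξ(φ) = ψ(φ)^*φ` of a field-dependent diffeomorphism `ψ : Φ → Diff(M)`. -/
def FieldSpace.verticalMap (ψ : Φ → Diffeo n M M) (φ : Φ) : Φ := FieldSpace.act (ψ φ) φ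

theorem FieldSpace.dSmooth_verticalMap {ψ : Φ → Diffeo n M M} (hψ : DSmooth ψ) :
    DSmooth (FieldSpace.verticalMap ψ) := fun _ P hP =>
  (FieldSpace.actPlot ⟨ψ ∘ P, hψ _ P hP⟩ ⟨P, hP⟩).2

/-- Two fields are related if they lie in the same `Diff(M)`-orbit. -/
def FieldSpace.orbitRel (Φ : FieldSpace M a) : Setoid Φ where
  r φ φ' := ∃ ψ : Diffeo n M M, φ' = FieldSpace.act ψ φ
  iseqv :=
    { refl := fun φ => ⟨Diffeomorph.refl _ _ _, Subtype.ext φ.1.pullback_refl.symm⟩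
      symm := by
        rintro φ _ ⟨ψ, rfl⟩
        refine ⟨ψ.symm, Subtype.ext ?_⟩
        change _ = (φ.1.pullback ψ).pullback ψ.symm
        rw [FieldConfig.pullback_pullback, Diffeomorph.symm_trans_self, FieldConfig.pullback_refl]
      trans := by
        rintro φ _ _ ⟨ψ, rfl⟩ ⟨ψ', rfl⟩
        exact ⟨ψ'.trans ψ, Subtype.ext (FieldConfig.pullback_pullback ψ' ψ φ.1)⟩ }

/-- The moduli space `Φ / Diff(M)`, with the quotient diffeology. -/
abbrev FieldSpace.Moduli (Φ : FieldSpace M a) : Type _ := Quotient Φ.orbitRel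

/-- The bundle projection `π : φ ↦ [φ]`. -/
def FieldSpace.proj (Φ : FieldSpace M a) (φ : Φ) : Φ.Moduli := Quotient.mk _ φ

variable {W : Type*} [AddCommGroup W] [Module ℝ W] [DiffeologicalSpace W] {k : ℕ}

/-- The transformation `α^ψ = Ξ⋆α` of a form under a field-dependent diffeomorphism. -/
def FieldSpace.verticalTransform (ψ : Φ → Diffeo n M M) (hψ : DSmooth ψ) (α : DiffForm Φ W k) :
    DiffForm Φ W k :=
  α.pullback (FieldSpace.verticalMap ψ) (FieldSpace.dSmooth_verticalMap hψ)

/-- Invariance: `R_ψ⋆ α = α` for all `ψ ∈ Diff(M)`. -/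
def IsInvariant (α : DiffForm Φ W k) : Prop :=
  ∀ ψ : Diffeo n M M, FieldSpace.verticalTransform (fun _ => ψ) (fun _ _ _ => isPlot_const) α = α

/-- Horizontality: `α` vanishes as soon as one of its arguments is a fundamental vertical vector
`X^v = d/dτ ψ_τ^*φ`. If `P` is constant along the direction `v`, then the velocity of
`r ↦ ψ(r)^* P(r)` in the direction `v` is such a vector, with `X` the velocity of
`τ ↦ ψ(r)⁻¹ ∘ ψ(r + τ v)` at `τ = 0`; every `X^v` with `X` the velocity of a smooth family in
`Diff(M)` arises in this way. -/
def IsHorizontal (α : DiffForm Φ W k) : Prop :=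
  ∀ {m : ℕ} (ψ : Plot (Diffeo n M M) m) (P : Plot Φ m) (v : Euc m),
    (∀ (r : Euc m) (t : ℝ), P (r + t • v) = P r) →
    ∀ (r : Euc m) (w : Fin k → Euc m) (i : Fin k), w i = v → α (FieldSpace.actPlot ψ P) r w = 0

/-- Basic forms: the invariant and horizontal ones. -/
def IsBasic (α : DiffForm Φ W k) : Prop := IsInvariant α ∧ IsHorizontal α

variable (N Φ) in
/-- A field-dependent dressing field: a smooth map `u : Φ → Diff(N, M)` with
`u(φ^ψ) = ψ⁻¹ ∘ u(φ)`. -/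
structure DressingField where
  toFun : Φ → Diffeo n N M
  smooth' : DSmooth toFun
  equivariant' : ∀ (ψ : Diffeo n M M) (φ : Φ),
    toFun (FieldSpace.act ψ φ) = (toFun φ).trans ψ.symm

instance : CoeFun (DressingField N Φ) fun _ => Φ → Diffeo n N M := ⟨DressingField.toFun⟩

namespace DressingField

variable (u : DressingField N Φ)

/-- The dressing map `F_u(φ) = φ^u = u(φ)^*φ`. -/
def dress (φ : Φ) : FieldConfig N a := φ.1.pullback (u φ)

theorem dSmooth_dress : DSmooth u.dress := fun m P hP =>
  FieldConfig.isPlot_pullback ⟨u ∘ P, u.smooth' m P hP⟩ ⟨fun r => (P r).1, hP⟩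

/-- The space `Φ^u` of dressed fields, with the diffeology of a subspace of the fields on `N`. -/
abbrev dressedSpace : Type _ := Set.range u.dress

/-- The dressing map, onto the space of dressed fields. -/
def dressMap (φ : Φ) : u.dressedSpace := ⟨u.dress φ, φ, rfl⟩

theorem dSmooth_dressMap : DSmooth u.dressMap := u.dSmooth_dress

/-- The dressed basis 1-form `dφ^u = F_u⋆ d[φ]`, with `d[φ]` the basis 1-form of the fields on `N`. -/
def dressedBasisForm [FiniteDimensional ℝ V] : DiffForm Φ (Variation N a) 1 :=
  (basisForm N a).pullback u.dress u.dSmooth_dress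

/-- The vector field `du(𝔛) ∘ u⁻¹` on `M`, for the velocity `𝔛` of the plot `P` at `r` in the
direction `v`. (The derivative at `x` lies in the tangent space at `u(u⁻¹(x)) = x`.) -/
def variationField {m : ℕ} (P : Plot Φ m) (r v : Euc m) : ∀ x : M, TangentSpace 𝓘(ℝ, Euc n) x :=
  fun x => mfderiv 𝓘(ℝ, Euc m) 𝓘(ℝ, Euc n) (fun r' => u (P r') ((u (P r)).symm x)) r v

/-- The dressing `F_u⋆ β` of a form, given the version `β` of the form on the base `Φ^u`. -/
def dressedForm (β : DiffForm u.dressedSpace W k) : DiffForm Φ W k :=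
  β.pullback u.dressMap u.dSmooth_dressMap

end DressingField

end Fields

end Frames

end

end Dressing

open Dressing

/-! Apart from the formula for dφ^u, the argument is formal. The equivariance of u makes F_u
constant on Diff(M)-orbits. For one fixed field φ₀, pulling dressed fields back along u(φ₀)⁻¹ gives
a global smooth section s of F_u (`dressSection`), and s ∘ F_u is the vertical map Ξ of the
field-dependent diffeomorphism φ ↦ u(φ) ∘ u(φ₀)⁻¹. So F_u separates orbits, and s supplies the
smooth inverse of the map induced on the moduli space.

Pullbacks along an orbit-constant map are basic and are fixed by every Ξ. Conversely, a basic form α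
is fixed by every Ξ (`IsBasic.verticalTransform_eq`), hence α = Ξ⋆α = F_u⋆(s⋆α); uniqueness follows
from F_u ∘ s = id.

For dφ^u along a plot P, write u(P r') = w_{r'} ∘ u(P r) with w_r = id. The dressed field at a frame
is then P(r') evaluated on a moving frame Tw_{r'} ∘ q, and the chain rule (`fderiv_apply_map`)
yields dφ plus a derivative along the velocity of that frame. This velocity is the natural lift of
the velocity of w (`mfderiv_map_toHom`), which in a chart is the symmetry of second derivatives. -/

namespace Dressing

/-! ### Differential forms on diffeological spaces -/

section Diffeological

variable {X Y : Type*} [DiffeologicalSpace X] [DiffeologicalSpace Y]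
  {W : Type*} [AddCommGroup W] [Module ℝ W] [DiffeologicalSpace W] {k : ℕ}

theorem Plot.ext {m : ℕ} {p q : Plot X m} (h : ∀ r, p r = q r) : p = q :=
  Subtype.ext (funext h)

theorem DiffForm.ext_apply {α β : DiffForm X W k}
    (h : ∀ (m : ℕ) (p : Plot X m) (r : Euc m) (v : Fin k → Euc m), α p r v = β p r v) : α = β := by
  ext m p r v
  exact h m p r v

/-- A form vanishes if one of its arguments is a direction along which the plot is constant. -/
theorem DiffForm.eq_zero_of_const (α : DiffForm X W k) {m : ℕ} (p : Plot X m) (v : Euc m)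
    (hp : ∀ (r : Euc m) (t : ℝ), p (r + t • v) = p r) (r : Euc m) (w : Fin k → Euc m) (i : Fin k)
    (hi : w i = v) : α p r w = 0 := by
  by_cases hv : v = 0
  · exact (α p r).map_coord_zero i (hi.trans hv)
  -- The orthogonal projection along v. It moves points only in the direction v, so p ∘ f = p, while
  -- its derivative kills v: reparametrising by f inserts a zero argument.
  let f : Euc m →L[ℝ] Euc m :=
    ContinuousLinearMap.id ℝ _ - ((‖v‖ ^ 2)⁻¹ • innerSL ℝ v).smulRight v
  have hf : ∀ x, f x = x + (-((‖v‖ ^ 2)⁻¹ * inner ℝ v x)) • v := fun x => by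
    simp [f, sub_eq_add_neg]
  have hfv : f v = 0 := by
    rw [hf, real_inner_self_eq_norm_sq, inv_mul_cancel₀ (by simpa using hv)]
    simp
  have hpf : p.reparam f f.contDiff = p := Plot.ext fun x => by
    change p (f x) = p x
    rw [hf, hp]
  rw [← hpf, α.reparam' p f f.contDiff]
  refine (α p (f r)).map_coord_zero i ?_
  rw [f.fderiv, hi, hfv]

theorem DiffForm.pullback_congr {f g : X → Y} (h : f = g) (hf : DSmooth f) (hg : DSmooth g)
    (β : DiffForm Y W k) : β.pullback f hf = β.pullback g hg := by
  subst h
  rfl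

end Diffeological

/-! ### Basic forms and field-dependent diffeomorphisms -/

section Fields

variable {n : ℕ} {M : Type*} [TopologicalSpace M] [ChartedSpace (Euc n) M]
  [IsManifold 𝓘(ℝ, Euc n) ∞ M]
  {N : Type*} [TopologicalSpace N] [ChartedSpace (Euc n) N] [IsManifold 𝓘(ℝ, Euc n) ∞ N]
  {V : Type*} [NormedAddCommGroup V] [NormedSpace ℝ V]
  {a : (Euc n ≃L[ℝ] Euc n) →* (V ≃ᵃ[ℝ] V)} {Φ : FieldSpace M a}
  {Y : Type*} [DiffeologicalSpace Y]
  {W : Type*} [AddCommGroup W] [Module ℝ W] [DiffeologicalSpace W] {k : ℕ}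

/-- The pullback of a form along an invariant map is unchanged by field-dependent diffeomorphisms. -/
theorem verticalTransform_pullback {F : Φ → Y} (hF : DSmooth F)
    (hinv : ∀ (ψ : Diffeo n M M) (φ : Φ), F (FieldSpace.act ψ φ) = F φ) (β : DiffForm Y W k)
    (ψ : Φ → Diffeo n M M) (hψ : DSmooth ψ) :
    FieldSpace.verticalTransform ψ hψ (β.pullback F hF) = β.pullback F hF :=
  DiffForm.pullback_congr (funext fun φ => hinv (ψ φ) φ)
    (hF.comp (FieldSpace.dSmooth_verticalMap hψ)) hF β

/-- The pullback of a form along an invariant map is basic. -/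
theorem isBasic_pullback {F : Φ → Y} (hF : DSmooth F)
    (hinv : ∀ (ψ : Diffeo n M M) (φ : Φ), F (FieldSpace.act ψ φ) = F φ) (β : DiffForm Y W k) :
    IsBasic (β.pullback F hF) := by
  refine ⟨fun ψ => verticalTransform_pullback hF hinv β _ _, ?_⟩
  intro m ψ P v hP r w i hi
  -- Invariance of F removes ψ: the image plot is F ∘ P, which is constant along v.
  refine DiffForm.eq_zero_of_const β _ v (fun r t => ?_) r w i hi
  change F (FieldSpace.act _ _) = F (FieldSpace.act _ _)
  rw [hinv, hinv, hP]

/-- A basic form is unchanged by field-dependent diffeomorphisms. -/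
theorem IsBasic.verticalTransform_eq {α : DiffForm Φ W k} (hα : IsBasic α)
    (ψ : Φ → Diffeo n M M) (hψ : DSmooth ψ) : FieldSpace.verticalTransform ψ hψ α = α := by
  refine DiffForm.ext_apply fun m P r w => ?_
  -- Plots are parametrised by some ℝᵈ, so the product ℝᵐ × ℝᵐ is transported there by
  -- `toEuclidean`.
  let d := Module.finrank ℝ (Euc m × Euc m)
  let e : (Euc m × Euc m) ≃L[ℝ] Euc d := toEuclidean
  let fst : Euc d →L[ℝ] Euc m := (ContinuousLinearMap.fst ℝ (Euc m) (Euc m)).comp (e.symm : Euc d →L[ℝ] Euc m × Euc m)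
  let snd : Euc d →L[ℝ] Euc m := (ContinuousLinearMap.snd ℝ (Euc m) (Euc m)).comp (e.symm : Euc d →L[ℝ] Euc m × Euc m)
  let ψP : Plot (Diffeo n M M) m := P.map ψ hψ
  -- The two-parameter plot Q(x, y) = ψ(P x)^* P(y) decouples the two dependences on the point. Its
  -- diagonal is Ξ ∘ P; its slice x = r is P moved by the single diffeomorphism ψ(P r).
  let Q : Plot Φ _ :=
    FieldSpace.actPlot (ψP.reparam fst fst.contDiff) (P.reparam snd snd.contDiff)
  let diag : Euc m →L[ℝ] Euc d :=
    (e : Euc m × Euc m →L[ℝ] Euc d).comp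
      ((ContinuousLinearMap.id ℝ (Euc m)).prod (ContinuousLinearMap.id ℝ (Euc m)))
  have hdiag : Q.reparam diag diag.contDiff = P.map _ (FieldSpace.dSmooth_verticalMap hψ) :=
    Plot.ext fun x => by
      change FieldSpace.act (ψ (P (e.symm (e (x, x))).1)) (P (e.symm (e (x, x))).2) = _
      rw [e.symm_apply_apply]
      rfl
  have hr : Q.reparam (fun s => e (r, s)) (e.contDiff.comp (contDiff_const.prodMk contDiff_id)) =
      P.map _ (FieldSpace.dSmooth_verticalMap (ψ := fun _ => ψ (P r))
        (fun _ _ _ => isPlot_const)) := Plot.ext fun x => by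
      change FieldSpace.act (ψ (P (e.symm (e (r, x))).1)) (P (e.symm (e (r, x))).2) = _
      rw [e.symm_apply_apply]
      rfl
  have hderiv : ∀ v, fderiv ℝ (fun s => e (r, s)) r v = e (0, v) := fun v => by
    have h : HasFDerivAt (fun s => e (r, s)) ((e : Euc m × Euc m →L[ℝ] Euc d).comp
        ((0 : Euc m →L[ℝ] Euc m).prod (ContinuousLinearMap.id ℝ (Euc m)))) r :=
      e.hasFDerivAt.comp r ((hasFDerivAt_const r r).prodMk (hasFDerivAt_id r))
    rw [h.fderiv]
    rfl
  have h1 : FieldSpace.verticalTransform ψ hψ α P r w =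
      α Q (e (r, r)) ((fun i => e (w i, 0)) + fun i => e (0, w i)) := by
    change α (P.map _ (FieldSpace.dSmooth_verticalMap hψ)) r w = _
    rw [← hdiag, α.reparam' Q diag diag.contDiff]
    congr 1
    funext i
    rw [diag.fderiv, Pi.add_apply, ← map_add, Prod.mk_add_mk, add_zero, zero_add]
    rfl
  have h2 : α P r w = α Q (e (r, r)) fun i => e (0, w i) := by
    conv_lhs => rw [← hα.1 (ψ (P r))]
    change α (P.map _ (FieldSpace.dSmooth_verticalMap (ψ := fun _ => ψ (P r))
      (fun _ _ _ => isPlot_const))) r w = _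
    rw [← hr, α.reparam' Q]
    simp only [hderiv]
  rw [h1, h2]
  -- Expand over the set s of slots that receive (wᵢ, 0). The argument P(y) of Q does not change
  -- along (wᵢ, 0), so horizontality kills every term with s nonempty; s = ∅ is the slice, where
  -- invariance gives α on P.
  refine ((α Q (e (r, r))).toMultilinearMap.map_add_univ _ _).trans ?_
  refine (Finset.sum_eq_single ∅ (fun s _ hs => ?_) (by simp)).trans (by simp)
  obtain ⟨i, hi⟩ := Finset.nonempty_iff_ne_empty.2 hs
  refine hα.2 _ _ (e (w i, 0)) (fun x t => ?_) _ _ i (Finset.piecewise_eq_of_mem _ _ _ hi)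
  change P (e.symm (x + t • e (w i, 0))).2 = P (e.symm x).2
  simp

theorem FieldConfig.isPlot_pullback_const {m : ℕ} (u : Diffeo n N M) (P : Plot (FieldConfig M a) m) :
    IsPlot fun r => (P r).pullback u :=
  FieldConfig.isPlot_pullback ⟨fun _ => u, isPlot_const⟩ P

/-! ### The dressing map, its sections and the moduli space -/

namespace DressingField

variable (u : DressingField N Φ)

/-- The two occurrences of ψ cancel: (ψ⁻¹ ∘ u(φ))^*(ψ^*φ) = (ψ ∘ ψ⁻¹ ∘ u(φ))^*φ. -/
theorem dress_act (ψ : Diffeo n M M) (φ : Φ) : u.dress (FieldSpace.act ψ φ) = u.dress φ := by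
  change (φ.1.pullback ψ).pullback (u (FieldSpace.act ψ φ)) = φ.1.pullback (u φ)
  rw [u.equivariant', FieldConfig.pullback_pullback]
  congr 1
  exact Diffeomorph.ext fun x => ψ.apply_symm_apply _

theorem dressMap_act (ψ : Diffeo n M M) (φ : Φ) :
    u.dressMap (FieldSpace.act ψ φ) = u.dressMap φ :=
  Subtype.ext (u.dress_act ψ φ)

theorem pullback_symm_dress (φ : Φ) : (u.dress φ).pullback (u φ).symm = φ.1 := by
  change (φ.1.pullback (u φ)).pullback (u φ).symm = φ.1
  rw [FieldConfig.pullback_pullback, Diffeomorph.symm_trans_self, FieldConfig.pullback_refl]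

/-- Undressing with the wrong diffeomorphism w still lands in the orbit of φ, because u(φ) ∘ w⁻¹ is
in Diff(M). This makes the sections take values in Φ and shows that F_u separates orbits. -/
theorem dress_pullback_symm (w : Diffeo n N M) (φ : Φ) :
    (u.dress φ).pullback w.symm = (FieldSpace.act (w.symm.trans (u φ)) φ).1 :=
  FieldConfig.pullback_pullback _ _ _

/-- The section of the dressing map through the field `φ₀`. -/
noncomputable def dressSection (φ₀ : Φ) (χ : u.dressedSpace) : Φ :=
  ⟨χ.1.pullback (u φ₀).symm, by
    obtain ⟨_, φ, rfl⟩ := χ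
    rw [u.dress_pullback_symm]
    exact Subtype.prop _⟩

theorem dSmooth_dressSection (φ₀ : Φ) : DSmooth (u.dressSection φ₀) := fun _ P hP =>
  FieldConfig.isPlot_pullback_const (u φ₀).symm ⟨fun r => (P r).1, hP⟩

theorem dressSection_dressMap (φ₀ φ : Φ) :
    u.dressSection φ₀ (u.dressMap φ) = FieldSpace.act ((u φ₀).symm.trans (u φ)) φ :=
  Subtype.ext (u.dress_pullback_symm _ _)

theorem dressMap_dressSection (φ₀ : Φ) (χ : u.dressedSpace) :
    u.dressMap (u.dressSection φ₀ χ) = χ := by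
  obtain ⟨_, φ, rfl⟩ := χ
  change u.dressMap (u.dressSection φ₀ (u.dressMap φ)) = u.dressMap φ
  rw [dressSection_dressMap, dressMap_act]

/-- The field-dependent diffeomorphism that moves every field to the section through `φ₀`. -/
theorem dSmooth_symm_trans (φ₀ : Φ) : DSmooth fun φ : Φ => (u φ₀).symm.trans (u φ) := by
  intro m P hP
  have h : ContMDiff (𝓘(ℝ, Euc m).prod 𝓘(ℝ, Euc n)) 𝓘(ℝ, Euc n) ∞
    (fun q : Euc m × N => u (P q.1) q.2) := u.smooth' m P hP
  exact h.comp (contMDiff_fst.prodMk ((u φ₀).symm.contMDiff.comp contMDiff_snd))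

/-- A section s of F_u satisfies s⋆F_u⋆β = β. A base field for s exists as soon as there is a plot
to test on, since every dressed field comes from some φ₀. -/
theorem dressedForm_injective : Function.Injective
    fun β : DiffForm u.dressedSpace W k => u.dressedForm β := by
  intro β β' h
  refine DiffForm.ext_apply fun m Q r v => ?_
  obtain ⟨φ₀, -⟩ := (Q r).2
  have hQ : (Q.map _ (u.dSmooth_dressSection φ₀)).map _ u.dSmooth_dressMap = Q :=
    Plot.ext fun x => u.dressMap_dressSection φ₀ (Q x)
  have := congrArg (fun γ : DiffForm Φ W k => γ (Q.map _ (u.dSmooth_dressSection φ₀)) r v) h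
  change β ((Q.map _ (u.dSmooth_dressSection φ₀)).map _ u.dSmooth_dressMap) r v =
    β' ((Q.map _ (u.dSmooth_dressSection φ₀)).map _ u.dSmooth_dressMap) r v at this
  rwa [hQ] at this

/-- The composite s ∘ F_u is a vertical map Ξ, and Ξ⋆ fixes basic forms. -/
theorem dressedForm_pullback_dressSection {α : DiffForm Φ W k} (hα : IsBasic α) (φ₀ : Φ) :
    u.dressedForm (α.pullback _ (u.dSmooth_dressSection φ₀)) = α := by
  conv_rhs => rw [← hα.verticalTransform_eq _ (u.dSmooth_symm_trans φ₀)]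
  exact DiffForm.pullback_congr (funext fun φ => u.dressSection_dressMap φ₀ φ)
    ((u.dSmooth_dressSection φ₀).comp u.dSmooth_dressMap) _ α

theorem existsUnique_dressedForm {α : DiffForm Φ W k} (hα : IsBasic α) :
    ∃! β : DiffForm u.dressedSpace W k, u.dressedForm β = α := by
  -- A section needs a base field φ₀. If Φ is empty, neither space has plots and each carries
  -- exactly one form.
  rcases isEmpty_or_nonempty Φ with hΦ | ⟨⟨φ₀⟩⟩
  · have hP : ∀ m, IsEmpty (Plot Φ m) := fun m => ⟨fun P => hΦ.elim (P 0)⟩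
    have hQ : ∀ m, IsEmpty (Plot u.dressedSpace m) := fun m => ⟨fun Q => by
      obtain ⟨φ, -⟩ := (Q 0).2
      exact hΦ.elim φ⟩
    refine ⟨⟨fun {m} Q => (hQ m).elim Q, fun {m} Q => (hQ m).elim Q, fun {m} _ Q => (hQ m).elim Q⟩,
      DiffForm.ext_apply fun m P => (hP m).elim P, fun β _ => DiffForm.ext_apply fun m Q => (hQ m).elim Q⟩
  · exact ⟨_, u.dressedForm_pullback_dressSection hα φ₀, fun β hβ =>
      u.dressedForm_injective (hβ.trans (u.dressedForm_pullback_dressSection hα φ₀).symm)⟩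

/-- The dressing map realises the projection to the moduli space. -/
theorem exists_moduli_equiv : ∃ e : Φ.Moduli ≃ u.dressedSpace, DSmooth e ∧ DSmooth e.symm ∧
    ∀ φ : Φ, e (Φ.proj φ) = u.dressMap φ := by
  let e₀ : Φ.Moduli → u.dressedSpace := Quotient.lift u.dressMap (by
    rintro φ _ ⟨ψ, rfl⟩
    exact (u.dressMap_act ψ φ).symm)
  have hinj : Function.Injective e₀ := by
    rintro ⟨φ⟩ ⟨φ'⟩ h
    -- If the dressed fields agree, undressing their common value with u(φ') gives φ' on one side
    -- and the image of φ under u(φ) ∘ u(φ')⁻¹ on the other.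
    refine Quotient.sound ⟨(u φ').symm.trans (u φ), Subtype.ext ?_⟩
    rw [← u.dress_pullback_symm, show u.dress φ = u.dress φ' from congrArg Subtype.val h,
      u.pullback_symm_dress]
  have hsurj : Function.Surjective e₀ := by
    rintro ⟨_, φ, rfl⟩
    exact ⟨Φ.proj φ, rfl⟩
  refine ⟨Equiv.ofBijective e₀ ⟨hinj, hsurj⟩, ?_, ?_, fun φ => rfl⟩
  · intro m p hp
    -- A plot of the quotient lifts to Φ only locally, so smoothness is checked locally, on a lift.
    refine DiffeologicalSpace.locality fun r => ?_
    obtain ⟨U, hU, hr, q, hq, h⟩ := hp r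
    refine ⟨U, hU, hr, fun {l f} hf hfs => ?_⟩
    have : ((Equiv.ofBijective e₀ ⟨hinj, hsurj⟩ ∘ p) ∘ f) = u.dressMap ∘ (q ∘ f) := by
      funext x
      change e₀ (p (f x)) = _
      rw [h _ (hf x)]
      rfl
    rw [this]
    exact u.dSmooth_dressMap _ _ (isPlot_reparam hq hfs)
  · intro m p hp r
    obtain ⟨φ₀, -⟩ := (p r).2
    -- The section through φ₀ is globally defined, so it lifts the whole plot at once.
    refine ⟨Set.univ, isOpen_univ, trivial, _, u.dSmooth_dressSection φ₀ m p hp, fun r' _ => ?_⟩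
    refine (Equiv.symm_apply_eq _).2 ?_
    exact (u.dressMap_dressSection φ₀ (p r')).symm

end DressingField

end Fields

end Dressing

/-! ### Calculus for the variation formula -/

namespace Dressing

/-- Symmetry of second derivatives, for the two partial derivatives of a function on a product. -/
theorem exists_hasFDerivAt_fderiv_right {E F G : Type*} [NormedAddCommGroup E] [NormedSpace ℝ E]
    [NormedAddCommGroup F] [NormedSpace ℝ F] [NormedAddCommGroup G] [NormedSpace ℝ G]
    {f : E × F → G} {x : E} {y : F} (hf : ContDiffAt ℝ 2 f (x, y)) :
    ∃ D : E →L[ℝ] F →L[ℝ] G, HasFDerivAt (fun x' => fderiv ℝ (fun y' => f (x', y')) y) D x ∧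
      ∀ v, D v = fderiv ℝ (fun y' => fderiv ℝ (fun x' => f (x', y')) x v) y := by
  have hd : ∀ᶠ q in nhds (x, y), DifferentiableAt ℝ f q :=
    (hf.eventually (by simp)).mono fun q hq => hq.differentiableAt (by simp)
  have h2 : HasFDerivAt (fderiv ℝ f) (fderiv ℝ (fderiv ℝ f) (x, y)) (x, y) :=
    ((hf.fderiv_right (m := 1) (by norm_num)).differentiableAt (by simp)).hasFDerivAt
  have hsymm : IsSymmSndFDerivAt ℝ f (x, y) := hf.isSymmSndFDerivAt (by simp)
  have hx : ∀ᶠ x' in nhds x, DifferentiableAt ℝ f (x', y) :=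
    (Continuous.prodMk_left y).continuousAt.eventually hd
  have hy : ∀ᶠ y' in nhds y, DifferentiableAt ℝ f (x, y') :=
    (Continuous.prodMk_right x).continuousAt.eventually hd
  have e1 : (fun x' => fderiv ℝ (fun y' => f (x', y')) y) =ᶠ[nhds x]
      fun x' => (fderiv ℝ f (x', y)).comp (ContinuousLinearMap.inr ℝ E F) := by
    filter_upwards [hx] with x' h
    exact (h.hasFDerivAt.comp y (hasFDerivAt_prodMk_right x' y)).fderiv
  refine ⟨((ContinuousLinearMap.compL ℝ F (E × F) G).flip (ContinuousLinearMap.inr ℝ E F)).comp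
    ((fderiv ℝ (fderiv ℝ f) (x, y)).comp (ContinuousLinearMap.inl ℝ E F)), ?_, fun v => ?_⟩
  · refine HasFDerivAt.congr_of_eventuallyEq ?_ e1
    exact ((ContinuousLinearMap.compL ℝ F (E × F) G).flip
      (ContinuousLinearMap.inr ℝ E F)).hasFDerivAt.comp x
        (h2.comp x (hasFDerivAt_prodMk_left x y))
  · have e2 : (fun y' => fderiv ℝ (fun x' => f (x', y')) x v) =ᶠ[nhds y]
        fun y' => fderiv ℝ f (x, y') (v, 0) := by
      filter_upwards [hy] with y' h
      rw [(h.hasFDerivAt.comp x (hasFDerivAt_prodMk_left x y')).fderiv (f := fun x' => f (x', y'))]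
      rfl
    have h3 : HasFDerivAt (fun y' => fderiv ℝ f (x, y') (v, 0))
        ((ContinuousLinearMap.apply ℝ G (v, (0 : F))).comp
          ((fderiv ℝ (fderiv ℝ f) (x, y)).comp (ContinuousLinearMap.inr ℝ E F))) y :=
      (ContinuousLinearMap.apply ℝ G (v, (0 : F))).hasFDerivAt.comp y
        (h2.comp y (hasFDerivAt_prodMk_right x y))
    rw [e2.fderiv_eq, h3.fderiv]
    ext ζ
    -- Both sides are values of the second derivative of f on the vectors (v, 0) and (0, ζ), taken
    -- in opposite orders.
    exact hsymm.eq (v, 0) (0, ζ)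

theorem mfderiv_eq_fderiv_extChartAt {E E' H M : Type*} [NormedAddCommGroup E] [NormedSpace ℝ E]
    [NormedAddCommGroup E'] [NormedSpace ℝ E'] [TopologicalSpace H] {I : ModelWithCorners ℝ E' H}
    [TopologicalSpace M] [ChartedSpace H M] {f : E → M} {x : E}
    (hf : MDifferentiableAt 𝓘(ℝ, E) I f x) :
    mfderiv 𝓘(ℝ, E) I f x = fderiv ℝ (fun x' => extChartAt I (f x) (f x')) x := by
  rw [hf.mfderiv, ModelWithCorners.range_eq_univ, fderivWithin_univ]
  rfl

/-! ### Families of diffeomorphisms through the identity, in charts -/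

section Fields

variable {n : ℕ} {M : Type*} [TopologicalSpace M] [ChartedSpace (Euc n) M]
  [IsManifold 𝓘(ℝ, Euc n) ∞ M]
  {N : Type*} [TopologicalSpace N] [ChartedSpace (Euc n) N] [IsManifold 𝓘(ℝ, Euc n) ∞ N]
  {V : Type*} [NormedAddCommGroup V] [NormedSpace ℝ V] {m : ℕ}

/-- The family of diffeomorphisms `w`, in the chart at `y`. -/
noncomputable def localFamily (w : Euc m → Diffeo n M M) (y : M) (q : Euc m × Euc n) : Euc n :=
  extChartAt 𝓘(ℝ, Euc n) y (w q.1 ((extChartAt 𝓘(ℝ, Euc n) y).symm q.2))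

theorem contMDiff_plot (w : Plot (Diffeo n N M) m) :
    ContMDiff (𝓘(ℝ, Euc m).prod 𝓘(ℝ, Euc n)) 𝓘(ℝ, Euc n) ∞ fun q : Euc m × N => w q.1 q.2 :=
  w.2

theorem contMDiff_plot_apply (w : Plot (Diffeo n N M) m) (x : N) :
    ContMDiff 𝓘(ℝ, Euc m) 𝓘(ℝ, Euc n) ∞ fun r => w r x :=
  (contMDiff_plot w).comp (contMDiff_id.prodMk contMDiff_const)

/-- Since w_r fixes y, the point w_r(y) lies in the source of the chart at y, so the outer chart is
smooth there. -/
theorem contDiffAt_localFamily (w : Plot (Diffeo n M M) m) (y : M) {r : Euc m}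
    (hr : ∀ x, w r x = x) :
    ContDiffAt ℝ ∞ (localFamily w y) (r, extChartAt 𝓘(ℝ, Euc n) y y) := by
  rw [← contMDiffAt_iff_contDiffAt]
  have h1 : ContMDiffAt 𝓘(ℝ, Euc m × Euc n) 𝓘(ℝ, Euc n) ∞
      (fun q : Euc m × Euc n => (extChartAt 𝓘(ℝ, Euc n) y).symm q.2)
      (r, extChartAt 𝓘(ℝ, Euc n) y y) :=
    (((contMDiffOn_extChartAt_symm y).contMDiffAt (extChartAt_target_mem_nhds y)).comp
      (r, extChartAt 𝓘(ℝ, Euc n) y y) contDiff_snd.contMDiff.contMDiffAt)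
  have h2 : ContMDiffAt 𝓘(ℝ, Euc m × Euc n) 𝓘(ℝ, Euc n) ∞
      (fun q : Euc m × Euc n => w q.1 ((extChartAt 𝓘(ℝ, Euc n) y).symm q.2))
      (r, extChartAt 𝓘(ℝ, Euc n) y y) :=
    (contMDiff_plot w).contMDiffAt.comp (r, extChartAt 𝓘(ℝ, Euc n) y y)
      (contDiff_fst.contMDiff.contMDiffAt.prodMk h1)
  refine ContMDiffAt.comp (r, extChartAt 𝓘(ℝ, Euc n) y y) ?_ h2
  refine contMDiffAt_extChartAt' ?_
  rw [hr, extChartAt_to_inv]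
  exact mem_chart_source _ y

/-- The velocity at the identity of a family of diffeomorphisms, in a chart. -/
theorem fderiv_localFamily_left (w : Plot (Diffeo n M M) m) (y : M) {r : Euc m}
    (hr : ∀ x, w r x = x) (v : Euc m) {z : Euc n} (hz : z ∈ (extChartAt 𝓘(ℝ, Euc n) y).target) :
    fderiv ℝ (fun r' => localFamily w y (r', z)) r v =
      localVectorField (fun x => mfderiv 𝓘(ℝ, Euc m) 𝓘(ℝ, Euc n) (fun r' => w r' x) r v) y z := by
  set x := (extChartAt 𝓘(ℝ, Euc n) y).symm z with hx
  have hxs : x ∈ (chartAt (Euc n) y).source := by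
    rw [← extChartAt_source 𝓘(ℝ, Euc n)]
    exact (extChartAt 𝓘(ℝ, Euc n) y).map_target hz
  have h := mfderiv_comp_apply_of_eq (I'' := 𝓘(ℝ, Euc n)) (g := extChartAt 𝓘(ℝ, Euc n) y)
    _ (mdifferentiableAt_extChartAt hxs) ((contMDiff_plot_apply w x).mdifferentiable (by simp) r)
    (hr x) v
  rw [← mfderiv_eq_fderiv]
  exact h.trans (congrArg (fun L : Euc n →L[ℝ] Euc n =>
    L (mfderiv 𝓘(ℝ, Euc m) 𝓘(ℝ, Euc n) (fun r' => w r' x) r v))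
    (TangentBundle.continuousLinearMapAt_trivializationAt hxs).symm)

/-- The tangent map of a diffeomorphism, in a chart. -/
theorem fderiv_localFamily_right (w : Plot (Diffeo n M M) m) (y : M) {r : Euc m}
    (hr : w r y ∈ (chartAt (Euc n) y).source) :
    fderiv ℝ (fun z => localFamily w y (r, z)) (extChartAt 𝓘(ℝ, Euc n) y y) =
      ((trivializationAt (Euc n) (TangentSpace 𝓘(ℝ, Euc n)) y).continuousLinearMapAt ℝ
        (w r y)).comp (mfderiv 𝓘(ℝ, Euc n) 𝓘(ℝ, Euc n) (w r) y) := by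
  have h1 : MDifferentiableAt 𝓘(ℝ, Euc n) 𝓘(ℝ, Euc n) (extChartAt 𝓘(ℝ, Euc n) y).symm
      (extChartAt 𝓘(ℝ, Euc n) y y) :=
    ((contMDiffOn_extChartAt_symm (n := ∞) y).contMDiffAt
      (extChartAt_target_mem_nhds y)).mdifferentiableAt (by simp)
  have h2 : mfderiv 𝓘(ℝ, Euc n) 𝓘(ℝ, Euc n) (extChartAt 𝓘(ℝ, Euc n) y).symm
      (extChartAt 𝓘(ℝ, Euc n) y y) = ContinuousLinearMap.id ℝ (Euc n) := by
    have := mfderivWithin_range_extChartAt_symm (I := 𝓘(ℝ, Euc n)) (x := y)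
    rwa [ModelWithCorners.range_eq_univ, mfderivWithin_univ] at this
  have h3 := fun ζ => mfderiv_comp_apply_of_eq (I'' := 𝓘(ℝ, Euc n)) (g := w r)
    _ ((w r).mdifferentiable (by simp) y) h1 (extChartAt_to_inv y) ζ
  have h4 := fun ζ => mfderiv_comp_apply_of_eq (I'' := 𝓘(ℝ, Euc n)) (g := extChartAt 𝓘(ℝ, Euc n) y)
    (y := w r y) (f := w r ∘ (extChartAt 𝓘(ℝ, Euc n) y).symm)
    (extChartAt 𝓘(ℝ, Euc n) y y) (mdifferentiableAt_extChartAt hr)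
    (((w r).mdifferentiable (by simp) _).comp _ h1) (congrArg (w r) (extChartAt_to_inv y)) ζ
  rw [TangentBundle.continuousLinearMapAt_trivializationAt hr, ← mfderiv_eq_fderiv]
  ext1 ζ
  refine (h4 ζ).trans (congrArg (mfderiv 𝓘(ℝ, Euc n) 𝓘(ℝ, Euc n) (extChartAt 𝓘(ℝ, Euc n) y) (w r y))
    ((h3 ζ).trans (congrArg (mfderiv 𝓘(ℝ, Euc n) 𝓘(ℝ, Euc n) (w r) y) ?_)))
  exact congrArg (fun L : Euc n →L[ℝ] Euc n => L ζ) h2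

/-! ### Moving frames and the natural lift -/

/-- The chart of `Hom(ℝⁿ, TM)` at a frame. -/
theorem extChartAt_toHom_apply (p q : Frame n M) :
    extChartAt (frameModel n) p.toHom q.toHom = (extChartAt 𝓘(ℝ, Euc n) p.base q.base,
      ((trivializationAt (Euc n) (TangentSpace 𝓘(ℝ, Euc n)) p.base).continuousLinearMapAt ℝ
        q.base).comp q.toHom.2) := by
  rw [FiberBundle.extChartAt]
  refine Prod.ext rfl ?_
  change (trivializationAt (Euc n →L[ℝ] Euc n) (fun x : M => Bundle.Trivial M (Euc n) x →L[ℝ]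
    TangentSpace 𝓘(ℝ, Euc n) x) p.base q.toHom).2 = _
  rw [hom_trivializationAt_apply]
  exact inCoordinates_trivial _ _ _ _ q.toHom.2

theorem contMDiff_map_toHom (w : Plot (Diffeo n N M) m) (p : Frame n N) :
    ContMDiff 𝓘(ℝ, Euc m) (frameModel n) ∞ fun r => (p.map (w r)).toHom :=
  (contMDiff_frame_map w).comp (contMDiff_id.prodMk (contMDiff_const (c := p.toHom)))

/-- The velocity of the family of frames `Tw_r ∘ p` is the natural lift of the velocity of `w`. -/
theorem mfderiv_map_toHom (w : Plot (Diffeo n M M) m) {r : Euc m} (hr : ∀ x, w r x = x)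
    (p : Frame n M) (hp : p.map (w r) = p) (v : Euc m) :
    (mfderiv 𝓘(ℝ, Euc m) (frameModel n) (fun r' => (p.map (w r')).toHom) r v :
        Euc n × (Euc n →L[ℝ] Euc n)) =
      frameLift (fun x => mfderiv 𝓘(ℝ, Euc m) 𝓘(ℝ, Euc n) (fun r' => w r' x) r v) p := by
  set y := p.base
  set X : ∀ x : M, TangentSpace 𝓘(ℝ, Euc n) x :=
    fun x => mfderiv 𝓘(ℝ, Euc m) 𝓘(ℝ, Euc n) (fun r' => w r' x) r v with hX
  set z := extChartAt 𝓘(ℝ, Euc n) y y with hz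
  let L : Euc n →L[ℝ] Euc n := p.toHom.2
  have hW := contDiffAt_localFamily w y hr
  -- D is the r-derivative of the z-derivative of w in the chart. Exchanging the two turns D v into
  -- the z-derivative of the velocity field, the DX of the natural lift.
  obtain ⟨D, hD, hDv⟩ := exists_hasFDerivAt_fderiv_right (hW.of_le ENat.LEInfty.out)
  have h1 : HasFDerivAt (fun r' => localFamily w y (r', z))
      (fderiv ℝ (fun r' => localFamily w y (r', z)) r) r :=
    DifferentiableAt.hasFDerivAt (DifferentiableAt.comp (g := localFamily w y)
      (f := fun r' => (r', z)) r (hW.differentiableAt (by simp))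
      (differentiableAt_id.prodMk (differentiableAt_const z)))
  have h2 : HasFDerivAt (fun r' => (fderiv ℝ (fun z' => localFamily w y (r', z')) z).comp
      L)
      (((ContinuousLinearMap.compL ℝ (Euc n) (Euc n) (Euc n)).flip
        L).comp D) r :=
    ((ContinuousLinearMap.compL ℝ (Euc n) (Euc n) (Euc n)).flip
      L).hasFDerivAt.comp r hD
  -- The chart formula for the moving frame is to be differentiated in r', so it must hold near r
  -- and not only at r.
  have hnear : ∀ᶠ r' in nhds r, w r' y ∈ (chartAt (Euc n) y).source := by
    refine (contMDiff_plot_apply w y).continuous.continuousAt.eventually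
      ((chartAt (Euc n) y).open_source.mem_nhds ?_)
    change w r y ∈ _
    rw [hr]
    exact mem_chart_source _ y
  have h3 : (fun r' => extChartAt (frameModel n) p.toHom (p.map (w r')).toHom) =ᶠ[nhds r]
      fun r' => (localFamily w y (r', z), (fderiv ℝ (fun z' => localFamily w y (r', z')) z).comp
        L) := by
    filter_upwards [hnear] with r' h
    rw [extChartAt_toHom_apply, fderiv_localFamily_right w y h]
    refine Prod.ext ?_ rfl
    change _ = extChartAt 𝓘(ℝ, Euc n) y (w r' ((extChartAt 𝓘(ℝ, Euc n) y).symm z))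
    rw [hz, extChartAt_to_inv]
    rfl
  have h4 := ((h1.prodMk h2).congr_of_eventuallyEq h3).fderiv
  have h5 : mfderiv 𝓘(ℝ, Euc m) (frameModel n) (fun r' => (p.map (w r')).toHom) r =
      fderiv ℝ (fun r' => extChartAt (frameModel n) p.toHom (p.map (w r')).toHom) r := by
    rw [mfderiv_eq_fderiv_extChartAt ((contMDiff_map_toHom w p).mdifferentiable (by simp) r), hp]
  have h6 : ∀ z' ∈ (extChartAt 𝓘(ℝ, Euc n) y).target,
      fderiv ℝ (fun r' => localFamily w y (r', z')) r v = localVectorField X y z' :=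
    fun z' => fderiv_localFamily_left w y hr v
  -- Equality on a whole neighbourhood of z allows differentiation in z.
  have h7 : (fun z' => fderiv ℝ (fun r' => localFamily w y (r', z')) r v) =ᶠ[nhds z]
      localVectorField X y :=
    Filter.eventually_of_mem (extChartAt_target_mem_nhds y) h6
  have h8 : localVectorField X y z = X y := by
    rw [localVectorField, hz, extChartAt_to_inv]
    exact congrArg (fun A : Euc n →L[ℝ] Euc n => A (X y))
      ((TangentBundle.continuousLinearMapAt_trivializationAt (mem_chart_source _ y)).trans
        mfderiv_extChartAt_self)
  rw [h5, h4]
  refine Prod.ext ?_ ?_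
  · exact (h6 z (mem_extChartAt_target y)).trans h8
  · change (D v).comp L = _
    rw [hDv, h7.fderiv_eq]
    rfl

/-- The derivative of a family of functions on frames along a moving frame. -/
theorem fderiv_apply_map {P : Euc m → Frame n M → V} (hP : SmoothFamilyOn P Set.univ)
    (w : Plot (Diffeo n M M) m) {r : Euc m} (hr : ∀ x, w r x = x)
    (p : Frame n M) (hp : p.map (w r) = p) (v : Euc m) :
    fderiv ℝ (fun r' => P r' (p.map (w r'))) r v = velocity P r v p +
      lieDerivative (fun x => mfderiv 𝓘(ℝ, Euc m) 𝓘(ℝ, Euc n) (fun r' => w r' x) r v) (P r) p := by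
  -- G separates the dependence of the field on r' from that of the frame. Along r' ↦ (r', γ r') its
  -- two partial derivatives give the velocity of P and the Lie derivative.
  let G : Euc m × FrameHom n M → V := fun q => Frame.ext (P q.1) q.2
  let γ : Euc m → FrameHom n M := fun r' => (p.map (w r')).toHom
  have hG : MDifferentiableAt (𝓘(ℝ, Euc m).prod (frameModel n)) 𝓘(ℝ, V) G (r, p.toHom) :=
    ((hP _ ⟨trivial, p, rfl⟩).contMDiffAt
      ((isOpen_univ.prod isOpen_range_toHom).mem_nhds ⟨trivial, p, rfl⟩)).mdifferentiableAt (by simp)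
  have hγ : MDifferentiableAt 𝓘(ℝ, Euc m) (frameModel n) γ r :=
    (contMDiff_map_toHom w p).mdifferentiable (by simp) r
  have h1 := mfderiv_comp_apply_of_eq (f := fun r' => (r', γ r')) _ hG
    (mdifferentiableAt_id.prodMk hγ) (Prod.ext rfl (congrArg Frame.toHom hp)) v
  have h2 : (fun r' => P r' (p.map (w r'))) = G ∘ fun r' => (r', γ r') :=
    funext fun r' => (Frame.ext_toHom (P r') (p.map (w r'))).symm
  have h3 : mfderiv 𝓘(ℝ, Euc m) (𝓘(ℝ, Euc m).prod (frameModel n)) (fun r' => (r', γ r')) r =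
      (mfderiv 𝓘(ℝ, Euc m) 𝓘(ℝ, Euc m) id r).prod (mfderiv 𝓘(ℝ, Euc m) (frameModel n) γ r) :=
    mdifferentiableAt_id.mfderiv_prod hγ
  rw [mfderiv_id] at h3
  have h4 : (fun r' => G (r', p.toHom)) = fun r' => P r' p :=
    funext fun r' => Frame.ext_toHom (P r') p
  rw [h2, ← mfderiv_eq_fderiv]
  refine h1.trans ((mfderiv_prod_eq_add_apply hG).trans (congrArg₂ (· + ·) ?_ ?_))
  · rw [h3, mfderiv_eq_fderiv]
    exact congrArg (fun f : Euc m → V => fderiv ℝ f r v) h4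
  · rw [h3]
    exact congrArg (mfderiv (frameModel n) 𝓘(ℝ, V) (Frame.ext (P r)) p.toHom)
      (mfderiv_map_toHom w hr p hp v)

/-! ### The dressed basis form and the main theorem -/

variable {a : (Euc n ≃L[ℝ] Euc n) →* (V ≃ᵃ[ℝ] V)} {Φ : FieldSpace M a}

/-- The dressed basis 1-form in terms of the basis 1-form. -/
theorem DressingField.dressedBasisForm_apply [FiniteDimensional ℝ V] (u : DressingField N Φ)
    (P : Plot Φ m) (r v : Euc m) :
    (u.dressedBasisForm P r fun _ => v).1.1 =
      pullbackFrameFunction (u (P r))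
        ((basisFormOn a Φ.carrier P r fun _ => v).1.1 +
          lieDerivative (u.variationField P r v) (P r).1.1.1) := by
  funext p
  let uP : Plot (Diffeo n N M) m := P.map u u.smooth'
  -- Factoring u(P r') = w_{r'} ∘ u(P r) makes w the identity at r, with velocity du(𝔛) ∘ u⁻¹ there;
  -- the remaining fixed factor u(P r) is the outer pullback.
  let w : Plot (Diffeo n M M) m := ⟨fun r' => (uP r).symm.trans (uP r'),
    (contMDiff_plot uP).comp
      (contMDiff_fst.prodMk ((uP r).symm.contMDiff.comp contMDiff_snd))⟩
  have hw : ∀ x, w r x = x := fun x => (uP r).apply_symm_apply x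
  have hmap : ∀ r', (p.map (uP r)).map (w r') = p.map (uP r') := fun r' => by
    rw [← Frame.map_trans]
    congr 1
    exact Diffeomorph.ext fun x => congrArg (uP r') ((uP r).symm_apply_apply x)
  have h := fderiv_apply_map (P := fun r' => ((P r').1 : Frame n M → V)) P.2 w hw
    (p.map (uP r)) (hmap r) v
  simp only [hmap] at h
  exact h

end Fields

end Dressing

theorem mainTheorem6 {n : ℕ}
    {M : Type*} [TopologicalSpace M] [ChartedSpace (Euc n) M] [IsManifold 𝓘(ℝ, Euc n) ∞ M]
    {N : Type*} [TopologicalSpace N] [ChartedSpace (Euc n) N] [IsManifold 𝓘(ℝ, Euc n) ∞ N]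
    {V : Type*} [NormedAddCommGroup V] [NormedSpace ℝ V] [FiniteDimensional ℝ V]
    (a : (Euc n ≃L[ℝ] Euc n) →* (V ≃ᵃ[ℝ] V)) (Φ : FieldSpace M a) (u : DressingField N Φ) :
    -- the dressing map is `Diff(M)`-invariant
    (∀ (ψ : Diffeo n M M) (φ : Φ), u.dress (FieldSpace.act ψ φ) = u.dress φ) ∧
    -- the dressing map realises the bundle projection
    (∃ e : Φ.Moduli ≃ u.dressedSpace, DSmooth e ∧ DSmooth e.symm ∧
      ∀ φ : Φ, e (Φ.proj φ) = u.dressMap φ) ∧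
    -- the dressed basis 1-form
    (∀ (m : ℕ) (P : Plot Φ m) (r v : Euc m),
      (u.dressedBasisForm P r fun _ => v).1.1 =
        pullbackFrameFunction (u (P r))
          ((basisFormOn a Φ.carrier P r fun _ => v).1.1 +
            lieDerivative (u.variationField P r v) (P r).1.1.1)) ∧
    IsBasic u.dressedBasisForm ∧
    (∀ (ψ : Φ → Diffeo n M M) (hψ : DSmooth ψ),
      FieldSpace.verticalTransform ψ hψ u.dressedBasisForm = u.dressedBasisForm) ∧
    -- the dressed forms
    (∀ (W : Type*) [AddCommGroup W] [Module ℝ W] [DiffeologicalSpace W] (k : ℕ),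
      (∀ β : DiffForm u.dressedSpace W k,
        IsBasic (u.dressedForm β) ∧
        (∀ (ψ : Φ → Diffeo n M M) (hψ : DSmooth ψ),
          FieldSpace.verticalTransform ψ hψ (u.dressedForm β) = u.dressedForm β) ∧
        (∀ A : u.dressedSpace → (Variation N a) [⋀^Fin k]→ₗ[ℝ] W, HasExpression β A →
          ∀ (m : ℕ) (P : Plot Φ m) (r : Euc m) (v : Fin k → Euc m),
            u.dressedForm β P r v =
              A (u.dressMap (P r)) fun i => u.dressedBasisForm P r fun _ => v i)) ∧
      -- the basic forms are the pullbacks along the dressing map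
      (∀ α : DiffForm Φ W k, IsBasic α → ∃! β : DiffForm u.dressedSpace W k,
        u.dressedForm β = α)) := by
  refine ⟨u.dress_act, u.exists_moduli_equiv, fun m P r v => u.dressedBasisForm_apply P r v,
    isBasic_pullback u.dSmooth_dress u.dress_act _,
    verticalTransform_pullback u.dSmooth_dress u.dress_act _, ?_⟩
  intro W _ _ _ k
  exact ⟨fun β => ⟨isBasic_pullback u.dSmooth_dressMap u.dressMap_act β,
    verticalTransform_pullback u.dSmooth_dressMap u.dressMap_act β,
    -- On the plot F_u ∘ P the basis form of the fields on N is by definition the dressed basis form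
    -- on P.
    fun A hA m P r v => hA (P.map u.dressMap u.dSmooth_dressMap) r v⟩,
    fun α hα => u.existsUnique_dressedForm hα⟩
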